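/- Let $D=(V,A)$ be a finite directed graph with $V\neq\emptyset$ (loops and parallel arcs are allowed), and let $k\ge 0$ be an integer. For $Z\subseteq V$ let $\delta^{in}_D(Z)$ be the set of arcs with head in $Z$ and tail outside $Z$, and write $\delta^{in}_D(v)=\delta^{in}_D(\{v\})$. For every $v\in V$ let $M_v=(\delta^{in}_D(v),r_v)$ be a matroid with ground set $\delta^{in}_D(v)$ and rank function $r_v$, and let $r^\oplus$ be the rank function of the direct sum of the matroids $M_v$ $(v\in V)$. A spanning arborescence of $D$ is an arc set that is a spanning tree on $V$ in the undirected sense and in which every node has in-degree at most one. A $k$-arborescence is the union of $k$ pairwise arc-disjoint spanning arborescences (possibly with different roots); it is the empty set when $k=0$. A $k$-arborescence $F\subseteq A$ is matroid-restricted if $F\cap\delta^{in}_D(v)$ is independent in $M_v$ for every $v\in V$. A subpartition of $V$ is a (possibly empty) collection of pairwise disjoint non-empty subsets of $V$. Then there exists a matroid-restricted $k$-arborescence in $D$ if and only if, for every subpartition $\mathcal{X}$ of $V$, $$\sum_{X\in\mathcal{X}} r^\oplus\bigl(\delta^{in}_D(X)\bigr)\ \ge\ k\,(|\mathcal{X}|-1).$$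 -/

import Mathlib

/-- A directed multigraph with node set `V` and arc set `A`: every arc has a tail and a head.
Parallel arcs and loops are allowed. -/
structure DirMultigraph (V A : Type*) where
  tail : A → V
  head : A → V

namespace DirMultigraph

/-- The set of arcs entering the node set `Z`. -/
def deltaIn {V A : Type*} (D : DirMultigraph V A) (Z : Set V) : Set A :=
  {a | D.tail a ∉ Z ∧ D.head a ∈ Z}

/-- The unordered pair of end nodes of an arc. -/
def ends {V A : Type*} (D : DirMultigraph V A) (a : A) : Sym2 V :=
  s(D.tail a, D.head a)

/-- The arc set `F`, viewed as an undirected multigraph on `V`, is a spanning tree: it has no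
loops and no parallel edges, and the simple graph on `V` that it therefore is, is a tree
(connected, with a nonempty node set, and without cycles). -/
structure IsSpanningTree {V A : Type*} (D : DirMultigraph V A) (F : Set A) : Prop where
  loopless : ∀ a ∈ F, D.tail a ≠ D.head a
  no_parallel : Set.InjOn D.ends F
  isTree : (SimpleGraph.fromEdgeSet (D.ends '' F)).IsTree

/-- A spanning arborescence: a spanning tree in the undirected sense in which every node has
in-degree at most one. -/
structure IsArborescence {V A : Type*} (D : DirMultigraph V A) (F : Set A) : Prop where
  isSpanningTree : D.IsSpanningTree F
  inDegree_le_one : ∀ v, (F ∩ D.deltaIn {v}).encard ≤ 1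

/-- A `k`-arborescence: the arc-disjoint union of `k` spanning arborescences. -/
def IsKArborescence {V A : Type*} (D : DirMultigraph V A) (k : ℕ) (F : Set A) : Prop :=
  ∃ T : Fin k → Set A, (∀ i, D.IsArborescence (T i)) ∧
    Pairwise (fun i j => Disjoint (T i) (T j)) ∧ F = ⋃ i, T i

/-- `F` is a `k`-arborescence that is matroid-restricted for the matroids `M v`. -/
def IsMatroidRestrictedKArborescence {V A : Type*} (D : DirMultigraph V A) (M : V → Matroid A)
    (k : ℕ) (F : Set A) : Prop :=
  D.IsKArborescence k F ∧ ∀ v, (M v).Indep (F ∩ D.deltaIn {v})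

theorem pairwise_disjoint_ground {V A : Type*} (D : DirMultigraph V A) (M : V → Matroid A)
    (hM : ∀ v, (M v).E = D.deltaIn {v}) :
    Pairwise (Function.onFun Disjoint fun v => (M v).E) := by
  intro u v huv
  simp only [Function.onFun, hM]
  refine Set.disjoint_left.2 fun a ha hb => huv ?_
  exact ha.2.symm.trans hb.2

/-- The direct sum of matroids `M v` on the sets of arcs entering the single nodes `v`. -/
def directSum {V A : Type*} (D : DirMultigraph V A) (M : V → Matroid A)
    (hM : ∀ v, (M v).E = D.deltaIn {v}) : Matroid A :=
  Matroid.disjointSigma M (D.pairwise_disjoint_ground M hM)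

/-- The rank of `E` in the direct sum. All arc sets that occur are finite, so that the extended
rank is a natural number. -/
noncomputable def sumRank {V A : Type*} (D : DirMultigraph V A) (M : V → Matroid A)
    (hM : ∀ v, (M v).E = D.deltaIn {v}) (E : Set A) : ℕ :=
  ((D.directSum M hM).eRk E).toNat

end DirMultigraph

/-- A subpartition of `V`: a finite collection of pairwise disjoint nonempty subsets of `V`
(possibly with no members at all). -/
structure IsSubpartition {V : Type*} (P : Finset (Set V)) : Prop where
  nonempty : ∀ X ∈ P, X.Nonempty
  pairwiseDisjoint : (P : Set (Set V)).PairwiseDisjoint id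

/-! Necessity: an arborescence enters every nonempty set that avoids its root, and at most one
member of a subpartition contains the root. Summing over the `k` arborescences gives the inequality,
since their independent union has at most the rank's number of arcs in each cut.

Sufficiency rests on three uncrossing arguments about `cutRank`, which is submodular. First,
`exists_roots` takes minimal node weights `m` with `k ≤ cutRank X + m(X)` for nonempty `X`; the
maximal tight sets form a subpartition covering the support of `m`, and the hypothesis then gives
total weight `k`. Secondly, `exists_indep_forall_le_ncard` shrinks the matroids to a minimal family
of rank functions that keeps this condition. If an arc could be neither deleted nor contracted, two
tight sets would contradict strict submodularity. So every arc is a loop or a coloop, and the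
non-loops form an independent set `F` whose in-degrees replace the ranks. Finally, the cut condition
for `F` is the one in Edmonds' disjoint branchings theorem with the roots prescribed by `m`, proved
by Lovász's argument; branchings with a single root are spanning arborescences. -/

/-- `ρ` is the rank function of a matroid on `A`. -/
structure IsRankFunction {A : Type*} (ρ : Set A → ℕ) : Prop where
  empty : ρ ∅ = 0
  singleton_le : ∀ a, ρ {a} ≤ 1
  mono : Monotone ρ
  submod : ∀ S T, ρ (S ∩ T) + ρ (S ∪ T) ≤ ρ S + ρ T

/-! ### Rank functions under deletion and contraction -/

namespace IsRankFunction

variable {A : Type*} {ρ : Set A → ℕ}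

theorem insert_le (h : IsRankFunction ρ) (a : A) (S : Set A) : ρ (insert a S) ≤ ρ S + ρ {a} := by
  have := h.submod {a} S
  rw [Set.singleton_union] at this
  omega

theorem le_insert (h : IsRankFunction ρ) (a : A) (S : Set A) : ρ S ≤ ρ (insert a S) :=
  h.mono (Set.subset_insert a S)

theorem singleton_le_insert (h : IsRankFunction ρ) (a : A) (S : Set A) : ρ {a} ≤ ρ (insert a S) :=
  h.mono (Set.singleton_subset_iff.2 (Set.mem_insert a S))

/-- Deleting `a` and adding it again as a loop. -/
theorem delete (h : IsRankFunction ρ) (a : A) : IsRankFunction fun S => ρ (S \ {a}) where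
  empty := by simpa using h.empty
  singleton_le b := (h.mono Set.sdiff_subset).trans (h.singleton_le b)
  mono S T hST := h.mono (Set.sdiff_subset_sdiff_left hST)
  submod S T := by
    have := h.submod (S \ {a}) (T \ {a})
    rwa [← Set.union_sdiff_distrib, show S \ {a} ∩ (T \ {a}) = (S ∩ T) \ {a} by grind] at this

open Classical in
/-- The rank function after contracting `a` and, unless `a` is a loop, adding it again as a
coloop. -/
noncomputable def contract (ρ : Set A → ℕ) (a : A) (S : Set A) : ℕ :=
  ρ (insert a S) - if a ∈ S then 0 else ρ {a}

theorem contract_of_mem {a : A} {S : Set A} (ha : a ∈ S) : contract ρ a S = ρ S := by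
  simp [contract, ha]

theorem contract_of_notMem {a : A} {S : Set A} (ha : a ∉ S) :
    contract ρ a S = ρ (insert a S) - ρ {a} := by
  simp [contract, ha]

theorem contract_le (h : IsRankFunction ρ) (a : A) (S : Set A) : contract ρ a S ≤ ρ S := by
  by_cases ha : a ∈ S
  · rw [contract_of_mem ha]
  · rw [contract_of_notMem ha]
    have := h.insert_le a S
    omega

theorem le_contract_add_one (h : IsRankFunction ρ) (a : A) (S : Set A) :
    ρ S ≤ contract ρ a S + 1 := by
  by_cases ha : a ∈ S
  · rw [contract_of_mem ha]; omega
  · rw [contract_of_notMem ha]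
    have := h.le_insert a S
    have := h.singleton_le a
    omega

theorem le_delete_add_one (h : IsRankFunction ρ) (a : A) (S : Set A) :
    ρ S ≤ ρ (S \ {a}) + 1 := by
  have h1 := h.insert_le a (S \ {a})
  have h2 := h.singleton_le a
  have h3 : ρ S ≤ ρ (insert a (S \ {a})) := h.mono (by simp)
  omega

/-- Submodularity comes from `ρ` on the sets with `a` inserted: `S`, `T` miss `a` as often as `S ∩
T`, `S ∪ T` do, so the subtracted copies of `ρ {a}` balance. By `singleton_le_insert` the natural
subtraction never truncates. -/
theorem isRankFunction_contract (h : IsRankFunction ρ) (a : A) :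
    IsRankFunction (contract ρ a) where
  empty := by
    have := h.contract_le a ∅
    rw [h.empty] at this
    omega
  singleton_le b := (h.contract_le a _).trans (h.singleton_le b)
  mono S T hST := by
    by_cases hS : a ∈ S
    · rw [contract_of_mem hS, contract_of_mem (hST hS)]
      exact h.mono hST
    · have h1 := h.mono (Set.insert_subset_insert (a := a) hST)
      rw [contract_of_notMem hS]
      by_cases hT : a ∈ T
      · rw [contract_of_mem hT]
        rw [Set.insert_eq_of_mem hT] at h1
        omega
      · rw [contract_of_notMem hT]
        omega
  submod S T := by
    have h0 := h.submod (insert a S) (insert a T)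
    rw [← Set.insert_inter_distrib, ← Set.insert_union_distrib] at h0
    have h1 := h.singleton_le_insert a (S ∩ T)
    have h2 := h.singleton_le_insert a (S ∪ T)
    have h3 := h.singleton_le_insert a S
    have h4 := h.singleton_le_insert a T
    by_cases hS : a ∈ S
    · rw [contract_of_mem hS, contract_of_mem (S := S ∪ T) (Or.inl hS)]
      rw [Set.insert_eq_of_mem hS, Set.insert_eq_of_mem (s := S ∪ T) (Or.inl hS)] at h0
      by_cases hT : a ∈ T
      · rw [contract_of_mem hT, contract_of_mem (S := S ∩ T) ⟨hS, hT⟩]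
        exact h.submod S T
      · rw [contract_of_notMem hT, contract_of_notMem (S := S ∩ T) fun h => hT h.2]
        omega
    · rw [contract_of_notMem hS, contract_of_notMem (S := S ∩ T) fun h => hS h.1]
      by_cases hT : a ∈ T
      · rw [contract_of_mem hT, contract_of_mem (S := S ∪ T) (Or.inr hT)]
        rw [Set.insert_eq_of_mem hT, Set.insert_eq_of_mem (s := S ∪ T) (Or.inr hT)] at h0
        omega
      · rw [contract_of_notMem hT, contract_of_notMem (S := S ∪ T) fun h => h.elim hS hT]
        omega

/-- Strict submodularity: `a` is a coloop of `S` but lies in the closure of `T`. -/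
theorem submod_strict (h : IsRankFunction ρ) {a : A} {S T : Set A} (hS : ρ (S \ {a}) < ρ S)
    (hT : contract ρ a T < ρ T) : ρ (S ∩ T) + ρ (S ∪ T) < ρ S + ρ T := by
  have haS : a ∈ S := by
    by_contra haS
    rw [Set.sdiff_singleton_eq_self haS] at hS
    exact hS.false
  have haT : a ∉ T := fun haT => by
    rw [contract_of_mem haT] at hT
    exact hT.false
  rw [contract_of_notMem haT] at hT
  -- Removing `a` from `S` saves one unit of rank in `h1`; `h2` puts `a` back into the union at no
  -- cost, because `ρ (insert a T) = ρ T`.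
  have h1 := h.submod (S \ {a}) T
  have h2 := h.submod (S \ {a} ∪ T) (insert a T)
  have e1 : S \ {a} ∩ T = S ∩ T := by
    ext x
    simp only [Set.mem_inter_iff, Set.mem_sdiff, Set.mem_singleton_iff]
    refine ⟨fun hx => ⟨hx.1.1, hx.2⟩, fun hx => ⟨⟨hx.1, ?_⟩, hx.2⟩⟩
    rintro rfl
    exact haT hx.2
  have e2 : S ∪ T ⊆ S \ {a} ∪ T ∪ insert a T := by
    intro x hx
    by_cases hxa : x = a
    · exact Or.inr (Or.inl hxa)
    · exact Or.inl (hx.imp (fun hx => ⟨hx, hxa⟩) id)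
  have h3 := h.mono e2
  have h4 : ρ T ≤ ρ ((S \ {a} ∪ T) ∩ insert a T) :=
    h.mono (Set.subset_inter Set.subset_union_right (Set.subset_insert a T))
  have h5 := h.le_insert a T
  have h6 := h.singleton_le a
  rw [e1] at h1
  omega

end IsRankFunction

theorem Matroid.isRankFunction_toNat_eRk {A : Type*} [Finite A] (M : Matroid A) :
    IsRankFunction fun S => (M.eRk S).toNat where
  empty := by simp
  singleton_le a := by
    have := M.eRk_le_encard {a}
    rw [Set.encard_singleton] at this
    exact ENat.toNat_le_of_le_natCast this
  mono S T hST := ENat.toNat_le_toNat (M.eRk_mono hST)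
    (M.isRkFinite_of_finite T.toFinite).eRk_lt_top.ne
  submod S T := by
    have hfin : ∀ U, M.eRk U ≠ ⊤ := fun U => (M.isRkFinite_of_finite U.toFinite).eRk_lt_top.ne
    rw [← ENat.toNat_add (hfin _) (hfin _), ← ENat.toNat_add (hfin _) (hfin _)]
    exact ENat.toNat_le_toNat (M.eRk_inter_add_eRk_union_le S T)
      (WithTop.add_ne_top.2 ⟨hfin _, hfin _⟩)

/-! ### Submodularity of the cut rank -/

namespace DirMultigraph

variable {V A : Type*}

theorem deltaIn_univ (D : DirMultigraph V A) : D.deltaIn Set.univ = ∅ := by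
  ext; simp [deltaIn]

/-- The sum over all nodes `v` of the rank of the set of arcs that have head `v` and enter `X`. -/
def cutRank [Fintype V] (D : DirMultigraph V A) (ρ : V → Set A → ℕ) (X : Set V) : ℕ :=
  ∑ v, ρ v (D.deltaIn X ∩ D.deltaIn {v})

theorem deltaIn_inter_singleton_of_notMem (D : DirMultigraph V A) {X : Set V} {v : V}
    (hv : v ∉ X) : D.deltaIn X ∩ D.deltaIn {v} = ∅ := by
  ext a
  simp only [deltaIn, Set.mem_inter_iff, Set.mem_ofPred_eq, Set.mem_singleton_iff,
    Set.mem_empty_iff_false, iff_false]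
  rintro ⟨⟨-, h⟩, -, rfl⟩
  exact hv h

theorem deltaIn_inter_of_mem (D : DirMultigraph V A) {X Y : Set V} {v : V} (hX : v ∈ X)
    (hY : v ∈ Y) : D.deltaIn (X ∩ Y) ∩ D.deltaIn {v} =
      (D.deltaIn X ∩ D.deltaIn {v}) ∪ (D.deltaIn Y ∩ D.deltaIn {v}) := by
  ext a
  simp only [deltaIn, Set.mem_inter_iff, Set.mem_union, Set.mem_ofPred_eq, Set.mem_singleton_iff]
  by_cases h : D.head a = v
  · simp only [h, hX, hY]; tauto
  · simp [h]

theorem deltaIn_union_of_mem (D : DirMultigraph V A) {X Y : Set V} {v : V} (hX : v ∈ X)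
    (hY : v ∈ Y) : D.deltaIn (X ∪ Y) ∩ D.deltaIn {v} =
      (D.deltaIn X ∩ D.deltaIn {v}) ∩ (D.deltaIn Y ∩ D.deltaIn {v}) := by
  ext a
  simp only [deltaIn, Set.mem_inter_iff, Set.mem_union, Set.mem_ofPred_eq, Set.mem_singleton_iff]
  by_cases h : D.head a = v
  · simp only [h, hX, hY]; tauto
  · simp [h]

theorem deltaIn_union_subset_left (D : DirMultigraph V A) {X Y : Set V} {v : V} (hX : v ∈ X) :
    D.deltaIn (X ∪ Y) ∩ D.deltaIn {v} ⊆ D.deltaIn X ∩ D.deltaIn {v} := by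
  rintro a ⟨⟨h1, -⟩, h3, h4⟩
  exact ⟨⟨fun h => h1 (Or.inl h), (Set.mem_singleton_iff.1 h4) ▸ hX⟩, h3, h4⟩

/-- At a node of both sets, the arcs entering `X ∩ Y` and `X ∪ Y` are the union and the intersection
of those entering `X` and `Y`. At a node of only one set, the term of `X ∩ Y` vanishes and
monotonicity suffices. -/
theorem rank_deltaIn_submod (D : DirMultigraph V A) {ρ : Set A → ℕ} (hρ : IsRankFunction ρ)
    (X Y : Set V) (v : V) :
    ρ (D.deltaIn (X ∩ Y) ∩ D.deltaIn {v}) + ρ (D.deltaIn (X ∪ Y) ∩ D.deltaIn {v}) ≤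
      ρ (D.deltaIn X ∩ D.deltaIn {v}) + ρ (D.deltaIn Y ∩ D.deltaIn {v}) := by
  by_cases hX : v ∈ X
  · by_cases hY : v ∈ Y
    · rw [D.deltaIn_inter_of_mem hX hY, D.deltaIn_union_of_mem hX hY, add_comm]
      exact hρ.submod _ _
    · rw [D.deltaIn_inter_singleton_of_notMem (fun h => hY h.2), hρ.empty]
      have := hρ.mono (D.deltaIn_union_subset_left (Y := Y) hX)
      omega
  · rw [D.deltaIn_inter_singleton_of_notMem (fun h => hX h.1), hρ.empty]
    by_cases hY : v ∈ Y
    · have := hρ.mono (D.deltaIn_union_subset_left (Y := X) hY)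
      rw [Set.union_comm] at this
      omega
    · rw [D.deltaIn_inter_singleton_of_notMem (fun h => h.elim hX hY), hρ.empty]
      omega

theorem cutRank_submod [Fintype V] (D : DirMultigraph V A) {ρ : V → Set A → ℕ}
    (hρ : ∀ v, IsRankFunction (ρ v)) (X Y : Set V) :
    D.cutRank ρ (X ∩ Y) + D.cutRank ρ (X ∪ Y) ≤ D.cutRank ρ X + D.cutRank ρ Y := by
  simp only [cutRank, ← Finset.sum_add_distrib]
  exact Finset.sum_le_sum fun v _ => D.rank_deltaIn_submod (hρ v) X Y v

theorem mem_of_rank_lt (D : DirMultigraph V A) {ρ σ : Set A → ℕ} (hρ : IsRankFunction ρ)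
    {X : Set V} {v : V}
    (h : σ (D.deltaIn X ∩ D.deltaIn {v}) < ρ (D.deltaIn X ∩ D.deltaIn {v})) : v ∈ X := by
  by_contra hv
  rw [D.deltaIn_inter_singleton_of_notMem hv, hρ.empty] at h
  omega

theorem cutRank_submod_strict [Fintype V] (D : DirMultigraph V A) {ρ : V → Set A → ℕ}
    (hρ : ∀ v, IsRankFunction (ρ v)) {X Y : Set V} {a : A} {v : V}
    (hX : ρ v ((D.deltaIn X ∩ D.deltaIn {v}) \ {a}) < ρ v (D.deltaIn X ∩ D.deltaIn {v}))
    (hY : IsRankFunction.contract (ρ v) a (D.deltaIn Y ∩ D.deltaIn {v}) <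
      ρ v (D.deltaIn Y ∩ D.deltaIn {v})) :
    D.cutRank ρ (X ∩ Y) + D.cutRank ρ (X ∪ Y) < D.cutRank ρ X + D.cutRank ρ Y := by
  simp only [cutRank, ← Finset.sum_add_distrib]
  refine Finset.sum_lt_sum (fun v _ => D.rank_deltaIn_submod (hρ v) X Y v)
    ⟨v, Finset.mem_univ v, ?_⟩
  rw [D.deltaIn_inter_of_mem (D.mem_of_rank_lt (σ := fun S => ρ v (S \ {a})) (hρ v) hX)
    (D.mem_of_rank_lt (hρ v) hY), D.deltaIn_union_of_mem
    (D.mem_of_rank_lt (σ := fun S => ρ v (S \ {a})) (hρ v) hX) (D.mem_of_rank_lt (hρ v) hY),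
    add_comm (ρ v (_ ∪ _))]
  exact (hρ v).submod_strict hX hY

/-! ### Reduction of the matroids to one independent arc set -/

/-- If replacing `ρ v` by a rank function that is smaller by at most one violates the cut
condition, then it does so at a tight set. -/
theorem exists_tight_of_not_forall_le [Fintype V] [DecidableEq V] (D : DirMultigraph V A)
    {ρ : V → Set A → ℕ} {c : Set V → ℕ} {k : ℕ}
    (h : ∀ X : Set V, X.Nonempty → k ≤ D.cutRank ρ X + c X) {v : V} {σ : Set A → ℕ}
    (hσ : ∀ S, ρ v S ≤ σ S + 1)
    (hnot : ¬ ∀ X : Set V, X.Nonempty → k ≤ D.cutRank (Function.update ρ v σ) X + c X) :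
    ∃ X : Set V, D.cutRank ρ X + c X = k ∧
      σ (D.deltaIn X ∩ D.deltaIn {v}) < ρ v (D.deltaIn X ∩ D.deltaIn {v}) := by
  push Not at hnot
  obtain ⟨X, hX, hlt⟩ := hnot
  have hle := h X hX
  have e1 : D.cutRank ρ X = ρ v (D.deltaIn X ∩ D.deltaIn {v}) +
      ∑ u ∈ Finset.univ.erase v, ρ u (D.deltaIn X ∩ D.deltaIn {u}) :=
    (Finset.add_sum_erase _ _ (Finset.mem_univ v)).symm
  have e2 : D.cutRank (Function.update ρ v σ) X = σ (D.deltaIn X ∩ D.deltaIn {v}) +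
      ∑ u ∈ Finset.univ.erase v, ρ u (D.deltaIn X ∩ D.deltaIn {u}) := by
    rw [cutRank, ← Finset.add_sum_erase _ _ (Finset.mem_univ v), Function.update_self]
    congr 1
    refine Finset.sum_congr rfl fun u hu => ?_
    rw [Function.update_of_ne (Finset.ne_of_mem_erase hu)]
  have := hσ (D.deltaIn X ∩ D.deltaIn {v})
  exact ⟨X, by omega, by omega⟩

/-- Each element of `T` always contributes exactly its own rank, so it is a loop or a coloop and the
rank counts non-loops. -/
theorem rank_eq_ncard_of_forall_insert [Finite A] {ρ : Set A → ℕ} (hρ : IsRankFunction ρ)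
    {T F : Set A} (hF : ∀ a ∈ T, ρ {a} = 1 ↔ a ∈ F)
    (h : ∀ a ∈ T, ∀ S, a ∉ S → ρ (insert a S) = ρ S + ρ {a}) {S : Set A} (hS : S ⊆ T) :
    ρ S = (F ∩ S).ncard := by
  induction S, S.toFinite using Set.Finite.induction_on with
  | empty => simp [hρ.empty]
  | @insert a S haS _ ih =>
    have haT := hS (Set.mem_insert a S)
    rw [h a haT S haS, ih ((Set.subset_insert a S).trans hS)]
    by_cases haF : a ∈ F
    · rw [Set.inter_insert_of_mem haF, Set.ncard_insert_of_notMem (fun h => haS h.2),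
        (hF a haT).2 haF]
    · rw [Set.inter_insert_of_notMem haF]
      have h1 := hρ.singleton_le a
      have h2 := mt (hF a haT).1 haF
      omega

/-- A minimal family of rank functions satisfying the cut condition is modular. -/
theorem exists_ncard_eq_rank [Fintype V] [Finite A] (D : DirMultigraph V A)
    {ρ : V → Set A → ℕ} (hρ : ∀ v, IsRankFunction (ρ v)) {c : Set V → ℕ}
    (hc : ∀ X Y, c (X ∩ Y) + c (X ∪ Y) ≤ c X + c Y) {k : ℕ}
    (h : ∀ X : Set V, X.Nonempty → k ≤ D.cutRank ρ X + c X)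
    (hmin : ∀ σ : V → Set A → ℕ, (∀ v, IsRankFunction (σ v)) → σ ≤ ρ →
      (∀ X : Set V, X.Nonempty → k ≤ D.cutRank σ X + c X) → ρ ≤ σ) :
    ∃ F : Set A, ∀ v, ∀ S ⊆ D.deltaIn {v}, ρ v S = (F ∩ S).ncard := by
  classical
  refine ⟨{a | ρ (D.head a) {a} = 1}, fun v S hS => ?_⟩
  refine rank_eq_ncard_of_forall_insert (hρ v) (T := D.deltaIn {v}) (fun a ha => ?_)
    (fun a _ S haS => ?_) hS
  · obtain rfl : D.head a = v := ha.2
    rfl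
  have upd : ∀ σ : Set A → ℕ, IsRankFunction σ → (∀ S, σ S ≤ ρ v S) →
      (∀ X : Set V, X.Nonempty → k ≤ D.cutRank (Function.update ρ v σ) X + c X) →
      ∀ S, ρ v S ≤ σ S := by
    intro σ hσ hle hX S
    have hup := hmin (Function.update ρ v σ) (fun u => ?_) (fun u => ?_) hX v S
    · rwa [Function.update_self] at hup
    · rcases eq_or_ne u v with rfl | hu
      · rwa [Function.update_self]
      · rw [Function.update_of_ne hu]; exact hρ u
    · rcases eq_or_ne u v with rfl | hu
      · rw [Function.update_self]; exact hle
      · rw [Function.update_of_ne hu]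
  -- If deleting `a` is harmless, minimality makes `a` a loop.
  by_cases h1 : ∀ X : Set V, X.Nonempty →
      k ≤ D.cutRank (Function.update ρ v fun S => ρ v (S \ {a})) X + c X
  · have h2 := upd _ ((hρ v).delete a) (fun S => (hρ v).mono Set.sdiff_subset) h1
    have h3 := h2 {a}
    have h4 := h2 (insert a S)
    simp only [sdiff_self, Set.bot_eq_empty, (hρ v).empty] at h3
    rw [Set.insert_sdiff_of_mem _ (Set.mem_singleton a), Set.sdiff_singleton_eq_self haS] at h4
    have h5 := (hρ v).le_insert a S
    omega
  -- If contracting `a` is harmless, minimality makes `a` a coloop.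
  by_cases h2 : ∀ X : Set V, X.Nonempty →
      k ≤ D.cutRank (Function.update ρ v (IsRankFunction.contract (ρ v) a)) X + c X
  · have h3 := upd _ ((hρ v).isRankFunction_contract a) ((hρ v).contract_le a) h2 S
    rw [IsRankFunction.contract_of_notMem haS] at h3
    have h4 := (hρ v).insert_le a S
    have h5 := (hρ v).singleton_le_insert a S
    omega
  -- Otherwise a tight `X` blocks deletion and a tight `Y` blocks contraction. Both contain `v`, so
  -- the cut condition holds at `X ∩ Y` and `X ∪ Y`, against strict submodularity.
  obtain ⟨X, hX, hXlt⟩ := D.exists_tight_of_not_forall_le h ((hρ v).le_delete_add_one a) h1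
  obtain ⟨Y, hY, hYlt⟩ := D.exists_tight_of_not_forall_le h ((hρ v).le_contract_add_one a) h2
  have h3 := D.cutRank_submod_strict hρ hXlt hYlt
  have hvX : v ∈ X := D.mem_of_rank_lt (σ := fun S => ρ v (S \ {a})) (hρ v) hXlt
  have h4 := h (X ∩ Y) ⟨v, hvX, D.mem_of_rank_lt (hρ v) hYlt⟩
  have h5 := h (X ∪ Y) ⟨v, Or.inl hvX⟩
  have h6 := hc X Y
  omega

theorem ncard_eq_sum_ncard_inter_deltaIn [Fintype V] [Finite A] (D : DirMultigraph V A)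
    {S : Set A} (hS : ∀ a ∈ S, D.tail a ≠ D.head a) :
    S.ncard = ∑ v, (S ∩ D.deltaIn {v}).ncard := by
  rw [← finsum_eq_sum_of_fintype, ← Set.ncard_iUnion_of_finite (fun _ => Set.toFinite _)]
  · congr 1
    ext a
    simp only [Set.mem_iUnion, Set.mem_inter_iff, exists_and_left]
    exact ⟨fun ha => ⟨ha, D.head a, hS a ha, rfl⟩, fun ha => ha.1⟩
  · refine fun u v huv => Set.disjoint_left.2 fun a ha hb => huv ?_
    exact ha.2.2.symm.trans hb.2.2

theorem ne_of_mem_deltaIn (D : DirMultigraph V A) {X : Set V} {a : A} (ha : a ∈ D.deltaIn X) :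
    D.tail a ≠ D.head a :=
  fun h => ha.1 (h ▸ ha.2)

/-- The cut condition for the ranks yields an independent arc set that satisfies it. -/
theorem exists_indep_forall_le_ncard [Fintype V] [Finite A] (D : DirMultigraph V A)
    {ρ : V → Set A → ℕ} (hρ : ∀ v, IsRankFunction (ρ v)) {c : Set V → ℕ}
    (hc : ∀ X Y, c (X ∩ Y) + c (X ∪ Y) ≤ c X + c Y) {k : ℕ}
    (h : ∀ X : Set V, X.Nonempty → k ≤ D.cutRank ρ X + c X) :
    ∃ F : Set A, (∀ v, (F ∩ D.deltaIn {v}).ncard ≤ ρ v (F ∩ D.deltaIn {v})) ∧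
      ∀ X : Set V, X.Nonempty → k ≤ (F ∩ D.deltaIn X).ncard + c X := by
  obtain ⟨σ, hle, ⟨hσ, hcut⟩, hmin⟩ := exists_minimal_le_of_wellFoundedLT
    (fun σ : V → Set A → ℕ => (∀ v, IsRankFunction (σ v)) ∧
      ∀ X : Set V, X.Nonempty → k ≤ D.cutRank σ X + c X) ρ ⟨hρ, h⟩
  obtain ⟨F, hF⟩ := D.exists_ncard_eq_rank hσ hc hcut fun τ h1 h2 h3 => hmin ⟨h1, h3⟩ h2
  refine ⟨F, fun v => ?_, fun X hX => ?_⟩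
  · refine le_trans (le_of_eq ?_) (hle v _)
    rw [hF v _ Set.inter_subset_right, ← Set.inter_assoc, Set.inter_self]
  · have := hcut X hX
    rwa [cutRank, Finset.sum_congr rfl fun v _ => (hF v _ Set.inter_subset_right).trans
      (congrArg Set.ncard (Set.inter_assoc F _ _).symm), ← D.ncard_eq_sum_ncard_inter_deltaIn
      fun a ha => D.ne_of_mem_deltaIn ha.2] at this

/-! ### Placing the roots -/

/-- If every subpartition satisfies the partition inequality, then `k` roots can be placed so that
the cut condition holds. -/
theorem exists_roots [Fintype V] [Nonempty V] (D : DirMultigraph V A)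
    {ρ : V → Set A → ℕ} (hρ : ∀ v, IsRankFunction (ρ v)) (k : ℕ)
    (h : ∀ P : Finset (Set V), IsSubpartition P → k * P.card ≤ ∑ X ∈ P, D.cutRank ρ X + k) :
    ∃ m : V → ℕ, ∑ v, m v = k ∧
      ∀ X : Set V, X.Nonempty → k ≤ D.cutRank ρ X + ∑ v, X.indicator m v := by
  classical
  obtain ⟨m, hm, hmin⟩ := exists_minimal_of_wellFoundedLT
    (fun m : V → ℕ => ∀ X : Set V, X.Nonempty → k ≤ D.cutRank ρ X + ∑ v, X.indicator m v)
    ⟨fun _ => k, fun X ⟨v, hv⟩ => by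
      have := Finset.single_le_sum (f := fun u => X.indicator (fun _ => k) u)
        (fun _ _ => Nat.zero_le _) (Finset.mem_univ v)
      simp only [Set.indicator_of_mem hv] at this
      omega⟩
  have hmod : ∀ X Y : Set V, ∑ v, (X ∪ Y).indicator m v + ∑ v, (X ∩ Y).indicator m v =
      ∑ v, X.indicator m v + ∑ v, Y.indicator m v := fun X Y => by
    simp only [← Finset.sum_add_distrib, Set.indicator_union_add_inter_apply]
  let Tight : Set V → Prop := fun X => X.Nonempty ∧ D.cutRank ρ X + ∑ v, X.indicator m v = k
  have hunion : ∀ X Y, Tight X → Tight Y → (X ∩ Y).Nonempty → Tight (X ∪ Y) := by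
    intro X Y hX hY hXY
    refine ⟨hX.1.mono Set.subset_union_left, ?_⟩
    have h1 := hm _ hXY
    have h2 := hm (X ∪ Y) (hX.1.mono Set.subset_union_left)
    have h3 := D.cutRank_submod hρ X Y
    have h4 := hmod X Y
    have h5 := hX.2
    have h6 := hY.2
    omega
  -- Lowering `m v` by one must violate the condition at some set, which then contains `v` and has
  -- no slack.
  have htight : ∀ v, m v ≠ 0 → ∃ X, Tight X ∧ v ∈ X := by
    intro v hv
    have hlt : Function.update m v (m v - 1) < m := by
      rw [update_lt_self_iff]
      omega
    have hnot := mt (fun hP => hmin hP hlt.le) hlt.not_ge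
    push Not at hnot
    obtain ⟨X, hX, hXlt⟩ := hnot
    have hvX : v ∈ X := by
      by_contra hvX
      refine (hm X hX).not_gt (lt_of_le_of_lt (le_of_eq ?_) hXlt)
      congr 1
      refine Finset.sum_congr rfl fun u _ => ?_
      by_cases hu : u ∈ X
      · rw [Set.indicator_of_mem hu, Set.indicator_of_mem hu,
          Function.update_of_ne (ne_of_mem_of_not_mem hu hvX)]
      · rw [Set.indicator_of_notMem hu, Set.indicator_of_notMem hu]
    have hle : ∑ u, X.indicator m u ≤
        ∑ u, (X.indicator (Function.update m v (m v - 1)) u + if u = v then 1 else 0) := by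
      refine Finset.sum_le_sum fun u _ => ?_
      by_cases hu : u ∈ X
      · rw [Set.indicator_of_mem hu, Set.indicator_of_mem hu]
        by_cases huv : u = v
        · subst huv
          rw [Function.update_self, if_pos rfl]
          omega
        · rw [Function.update_of_ne huv]
          omega
      · rw [Set.indicator_of_notMem hu]
        omega
    rw [Finset.sum_add_distrib, Finset.sum_ite_eq' Finset.univ v, if_pos (Finset.mem_univ v)] at hle
    have := hm X hX
    exact ⟨X, ⟨hX, by omega⟩, hvX⟩
  refine ⟨m, le_antisymm ?_ ?_, hm⟩
  -- By `hunion` these sets are disjoint. Tightness gives `m(V) ≤ k * P.card - ∑ cutRank`, which the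
  -- partition inequality bounds by `k`.
  · let P : Finset (Set V) := Finset.univ.filter (Maximal Tight)
    have hP : ∀ X ∈ P, Maximal Tight X := fun X hX => (Finset.mem_filter.1 hX).2
    have hsub : IsSubpartition P := by
      refine ⟨fun X hX => (hP X hX).1.1, fun X hX Y hY hne => ?_⟩
      rw [Function.onFun, id, id, Set.disjoint_iff_inter_eq_empty]
      by_contra hXY
      have hU := hunion X Y (hP X hX).1 (hP Y hY).1 (Set.nonempty_iff_ne_empty.2 hXY)
      exact hne (((hP X hX).eq_of_le hU Set.subset_union_left).trans
        ((hP Y hY).eq_of_le hU Set.subset_union_right).symm)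
    have h1 : ∑ v, m v ≤ ∑ X ∈ P, ∑ v, X.indicator m v := by
      rw [Finset.sum_comm]
      refine Finset.sum_le_sum fun v _ => ?_
      rcases eq_or_ne (m v) 0 with hv | hv
      · omega
      obtain ⟨X, hX, hvX⟩ := htight v hv
      obtain ⟨Y, hXY, hY⟩ := exists_maximal_ge_of_wellFoundedGT Tight X hX
      have := Finset.single_le_sum (f := fun X : Set V => X.indicator m v)
        (fun _ _ => Nat.zero_le _) (Finset.mem_filter.2 ⟨Finset.mem_univ Y, hY⟩ : Y ∈ P)
      simpa only [Set.indicator_of_mem (hXY hvX)] using this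
    have h2 : ∑ X ∈ P, D.cutRank ρ X + ∑ X ∈ P, ∑ v, X.indicator m v = k * P.card := by
      rw [← Finset.sum_add_distrib, Finset.sum_congr rfl fun X hX => (hP X hX).1.2,
        Finset.sum_const, smul_eq_mul, mul_comm]
    have h3 := h P hsub
    omega
  -- No arc enters the whole node set, so its demand is met by `m` alone.
  · have h1 := hm Set.univ Set.univ_nonempty
    have h2 : D.cutRank ρ Set.univ = 0 :=
      Finset.sum_eq_zero fun v _ => by rw [D.deltaIn_univ, Set.empty_inter, (hρ v).empty]
    simpa [h2] using h1

/-- A function of total weight `k` is the counting function of a family of `k` elements. -/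
theorem exists_family_of_sum_eq {V : Type*} [Fintype V] {m : V → ℕ} {k : ℕ} (hm : ∑ v, m v = k) :
    ∃ r : Fin k → V, ∀ f : V → ℕ, ∑ i, f (r i) = ∑ v, m v * f v := by
  have e : (Σ v, Fin (m v)) ≃ Fin k := Fintype.equivFinOfCardEq (by simp [hm])
  refine ⟨fun i => (e.symm i).1, fun f => ?_⟩
  rw [Equiv.sum_comp e.symm fun x => f x.1, Fintype.sum_sigma]
  simp

/-! ### Edmonds' disjoint branchings theorem -/

/-- The arcs of `B` form a branching with root set `R` that reaches all nodes. -/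
structure IsSpanningBranching (D : DirMultigraph V A) (R : Set V) (B : Set A) : Prop where
  loopless : ∀ a ∈ B, D.tail a ≠ D.head a
  head_notMem : ∀ a ∈ B, D.head a ∉ R
  head_injOn : Set.InjOn D.head B
  reachable : ∀ v, ∃ u ∈ R, (SimpleGraph.fromEdgeSet (D.ends '' B)).Reachable u v

section Edmonds

variable {ι : Type*} [Fintype ι]

open Classical in
/-- The number of members of the family `R` that are disjoint from `X`. -/
noncomputable def avoidCount (R : ι → Set V) (X : Set V) : ℕ :=
  ∑ i, if Disjoint (R i) X then 1 else 0

theorem avoidCount_supermod_apply (R X Y : Set V) [Decidable (Disjoint R X)]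
    [Decidable (Disjoint R Y)] [Decidable (Disjoint R (X ∩ Y))] [Decidable (Disjoint R (X ∪ Y))] :
    ((if Disjoint R X then 1 else 0) + if Disjoint R Y then 1 else 0 : ℕ) ≤
      (if Disjoint R (X ∩ Y) then 1 else 0) + if Disjoint R (X ∪ Y) then 1 else 0 := by
  by_cases hX : Disjoint R X
  · rw [if_pos hX, if_pos (hX.mono_right Set.inter_subset_left)]
    by_cases hY : Disjoint R Y
    · rw [if_pos hY, if_pos (Set.disjoint_union_right.2 ⟨hX, hY⟩)]
    · rw [if_neg hY]; omega
  · rw [if_neg hX]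
    by_cases hY : Disjoint R Y
    · rw [if_pos hY, if_pos (hY.mono_right Set.inter_subset_right)]; omega
    · rw [if_neg hY]; omega

theorem avoidCount_supermod (R : ι → Set V) (X Y : Set V) :
    avoidCount R X + avoidCount R Y ≤ avoidCount R (X ∩ Y) + avoidCount R (X ∪ Y) := by
  classical
  simp only [avoidCount, ← Finset.sum_add_distrib]
  exact Finset.sum_le_sum fun i _ => avoidCount_supermod_apply (R i) X Y

/-- The member `R i` is counted on the right only, at `X ∩ Y`. -/
theorem avoidCount_supermod_strict {R : ι → Set V} {X Y : Set V} {i : ι}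
    (hX : ¬ Disjoint (R i) X) (hY : ¬ Disjoint (R i) Y) (hXY : Disjoint (R i) (X ∩ Y)) :
    avoidCount R X + avoidCount R Y < avoidCount R (X ∩ Y) + avoidCount R (X ∪ Y) := by
  classical
  simp only [avoidCount, ← Finset.sum_add_distrib]
  refine Finset.sum_lt_sum (fun i _ => avoidCount_supermod_apply (R i) X Y)
    ⟨i, Finset.mem_univ i, ?_⟩
  rw [if_neg hX, if_neg hY, if_pos hXY]
  omega

theorem avoidCount_le {R S : ι → Set V} {X Y : Set V}
    (h : ∀ i, Disjoint (R i) X → Disjoint (S i) Y) : avoidCount R X ≤ avoidCount S Y := by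
  classical
  refine Finset.sum_le_sum fun i _ => ?_
  by_cases hi : Disjoint (R i) X
  · rw [if_pos hi, if_pos (h i hi)]
  · rw [if_neg hi]; omega

theorem avoidCount_lt {R S : ι → Set V} {X Y : Set V}
    (h : ∀ i, Disjoint (R i) X → Disjoint (S i) Y) {i : ι} (hX : ¬ Disjoint (R i) X)
    (hY : Disjoint (S i) Y) : avoidCount R X < avoidCount S Y := by
  classical
  refine Finset.sum_lt_sum (fun j _ => ?_) ⟨i, Finset.mem_univ i, ?_⟩
  · by_cases hj : Disjoint (R j) X
    · rw [if_pos hj, if_pos (h j hj)]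
    · rw [if_neg hj]; omega
  · rw [if_neg hX, if_pos hY]; omega

theorem ncard_inter_deltaIn_submod [Finite A] (D : DirMultigraph V A) (F : Set A) (X Y : Set V) :
    (F ∩ D.deltaIn (X ∩ Y)).ncard + (F ∩ D.deltaIn (X ∪ Y)).ncard ≤
      (F ∩ D.deltaIn X).ncard + (F ∩ D.deltaIn Y).ncard := by
  rw [← Set.ncard_union_add_ncard_inter (F ∩ D.deltaIn (X ∩ Y)),
    ← Set.ncard_union_add_ncard_inter (F ∩ D.deltaIn X)]
  refine add_le_add (Set.ncard_le_ncard ?_) (Set.ncard_le_ncard ?_)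
  · rintro a (⟨hF, h1, h2, h3⟩ | ⟨hF, h1, h2⟩)
    · by_cases hX : D.tail a ∈ X
      · exact Or.inr ⟨hF, fun hY => h1 ⟨hX, hY⟩, h3⟩
      · exact Or.inl ⟨hF, hX, h2⟩
    · exact h2.imp (fun h => ⟨hF, fun hX => h1 (Or.inl hX), h⟩)
        fun h => ⟨hF, fun hY => h1 (Or.inr hY), h⟩
  · rintro a ⟨⟨hF, h1, h2, h3⟩, -, h4, h5⟩
    exact ⟨⟨hF, fun hX => h4 (Or.inl hX), h2⟩, hF, fun hY => h4 (Or.inr hY), h3⟩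

/-- The key step in Lovász's proof of Edmonds' theorem: one of the branchings can be extended by
an arc without violating the cut condition. -/
theorem exists_arc_extending [Finite V] [Finite A] [DecidableEq ι] (D : DirMultigraph V A)
    {F : Set A} {R : ι → Set V}
    (h : ∀ X : Set V, X.Nonempty → avoidCount R X ≤ (F ∩ D.deltaIn X).ncard)
    {i : ι} (hi : R i ≠ Set.univ) :
    ∃ a ∈ F, D.tail a ∈ R i ∧ D.head a ∉ R i ∧ ∀ X : Set V, X.Nonempty →
      avoidCount (Function.update R i (insert (D.head a) (R i))) X ≤
        ((F \ {a}) ∩ D.deltaIn X).ncard := by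
  obtain ⟨w, hw⟩ := (Set.ne_univ_iff_exists_notMem _).1 hi
  -- A minimal tight set that meets `R i` without lying inside it. The whole node set qualifies: no
  -- arc enters it, so the cut condition forces its `avoidCount` to be zero, hence `R i` is
  -- nonempty.
  obtain ⟨X, ⟨hXt, hXR, hXn⟩, hmin⟩ := exists_minimal_of_wellFoundedLT
    (fun X : Set V => avoidCount R X = (F ∩ D.deltaIn X).ncard ∧ ¬ Disjoint (R i) X ∧
      (X \ R i).Nonempty) ⟨Set.univ, by
        have h1 := h Set.univ ⟨w, trivial⟩
        rw [D.deltaIn_univ, Set.inter_empty, Set.ncard_empty] at h1 ⊢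
        refine ⟨by omega, fun hd => ?_, w, trivial, hw⟩
        have h2 : avoidCount (fun _ : ι => (Set.univ : Set V)) (Set.univ : Set V) <
            avoidCount R Set.univ :=
          avoidCount_lt (i := i)
            (fun _ hd => absurd (Set.disjoint_left.1 hd (Set.mem_univ w)) (by simp))
            (fun hd => Set.disjoint_left.1 hd (Set.mem_univ w) trivial) hd
        omega⟩
  -- Since `R i` avoids `X \ R i` but not the tight set `X`, more arcs enter `X \ R i` than `X`;
  -- some arc thus runs from `X ∩ R i` to `X \ R i`.
  have h1 : avoidCount R X < avoidCount R (X \ R i) :=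
    avoidCount_lt (fun j hj => hj.mono_right Set.sdiff_subset) hXR Set.disjoint_sdiff_right
  have h2 := h _ hXn
  obtain ⟨a, ⟨haF, hat, hah⟩, haX⟩ :=
    Set.exists_mem_notMem_of_ncard_lt_ncard (s := F ∩ D.deltaIn X)
      (t := F ∩ D.deltaIn (X \ R i)) (by omega)
  have htX : D.tail a ∈ X := by
    by_contra htX
    exact haX ⟨haF, htX, hah.1⟩
  have htR : D.tail a ∈ R i := by
    by_contra htR
    exact hat ⟨htX, htR⟩
  refine ⟨a, haF, htR, hah.2, fun Z hZ => ?_⟩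
  have hmono : ∀ j, Disjoint (Function.update R i (insert (D.head a) (R i)) j) Z →
      Disjoint (R j) Z := by
    intro j hj
    rcases eq_or_ne j i with rfl | hji
    · rw [Function.update_self] at hj
      exact hj.mono_left (Set.subset_insert _ _)
    · rwa [Function.update_of_ne hji] at hj
  have h3 := h Z hZ
  by_cases haZ : a ∈ D.deltaIn Z
  · have h4 : ((F \ {a}) ∩ D.deltaIn Z).ncard + 1 = (F ∩ D.deltaIn Z).ncard := by
      rw [← Set.inter_sdiff_right_comm]
      exact Set.ncard_sdiff_singleton_add_one ⟨haF, haZ⟩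
    by_cases hd : Disjoint (R i) Z
    · have h5 : avoidCount (Function.update R i (insert (D.head a) (R i))) Z < avoidCount R Z := by
        refine avoidCount_lt hmono (i := i) (fun hd' => ?_) hd
        rw [Function.update_self] at hd'
        exact Set.disjoint_left.1 hd' (Set.mem_insert _ _) haZ.2
      omega
    · have h5 := avoidCount_le hmono
      -- A violation at `Z` makes `Z` tight, and uncrossing makes `X ∩ Z` tight too. It meets `R i`,
      -- contains the head of `a` outside `R i`, but misses the tail of `a`, against the minimality
      -- of `X`.
      have hne : (X ∩ Z).Nonempty := ⟨_, hah.1, haZ.2⟩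
      by_contra hlt
      have htight : avoidCount R Z = (F ∩ D.deltaIn Z).ncard := by omega
      have h6 := h _ hne
      have h7 := h (X ∪ Z) (hne.mono fun x hx => Or.inl hx.1)
      have h8 := D.ncard_inter_deltaIn_submod F X Z
      by_cases hXZ : Disjoint (R i) (X ∩ Z)
      · have h9 := avoidCount_supermod_strict hXR hd hXZ
        omega
      · have h9 := avoidCount_supermod R X Z
        exact haZ.1 (hmin ⟨by omega, hXZ, _, ⟨hah.1, haZ.2⟩, hah.2⟩ Set.inter_subset_left htX).2
  · have h4 : (F \ {a}) ∩ D.deltaIn Z = F ∩ D.deltaIn Z := by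
      rw [← Set.inter_sdiff_right_comm, Set.sdiff_singleton_eq_self fun h => haZ h.2]
    rw [h4]
    exact (avoidCount_le hmono).trans h3

/-- Extending a spanning branching backwards by an arc that leaves the root set. -/
theorem IsSpanningBranching.insert {D : DirMultigraph V A} {R : Set V} {B : Set A} {a : A}
    (ht : D.tail a ∈ R) (hh : D.head a ∉ R)
    (hB : D.IsSpanningBranching (insert (D.head a) R) B) :
    D.IsSpanningBranching R (insert a B) where
  loopless := by
    rintro b (rfl | hb)
    · exact fun h => hh (h ▸ ht)
    · exact hB.loopless b hb
  head_notMem := by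
    rintro b (rfl | hb)
    · exact hh
    · exact fun h => hB.head_notMem b hb (Or.inr h)
  head_injOn := by
    rintro b (rfl | hb) c (rfl | hc) hbc
    · rfl
    · exact absurd (Or.inl hbc.symm) (hB.head_notMem c hc)
    · exact absurd (Or.inl hbc) (hB.head_notMem b hb)
    · exact hB.head_injOn hb hc hbc
  reachable v := by
    obtain ⟨u, hu, huv⟩ := hB.reachable v
    have huv' := huv.mono (SimpleGraph.fromEdgeSet_mono
      (Set.image_mono (f := D.ends) (Set.subset_insert a B)))
    rcases hu with rfl | hu
    · refine ⟨D.tail a, ht, SimpleGraph.Reachable.trans (SimpleGraph.Adj.reachable ?_) huv'⟩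
      exact (SimpleGraph.fromEdgeSet_adj _).2
        ⟨⟨a, Set.mem_insert a B, rfl⟩, fun h => hh (h ▸ ht)⟩
    · exact ⟨u, hu, huv'⟩

/-- Edmonds' disjoint branchings theorem. -/
theorem exists_disjoint_spanningBranchings [Finite V] [Finite A] (D : DirMultigraph V A) (F : Set A)
    (R : ι → Set V) (h : ∀ X : Set V, X.Nonempty → avoidCount R X ≤ (F ∩ D.deltaIn X).ncard) :
    ∃ B : ι → Set A, (∀ i, B i ⊆ F) ∧ Pairwise (fun i j => Disjoint (B i) (B j)) ∧
      ∀ i, D.IsSpanningBranching (R i) (B i) := by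
  classical
  -- The measure is the number of nodes still to be reached, summed over the branchings; each new
  -- arc adds its head to one root set.
  induction hn : ∑ i, (R i)ᶜ.ncard using Nat.strong_induction_on generalizing F R with
  | _ n ih =>
  by_cases hR : ∀ i, R i = Set.univ
  · refine ⟨fun _ => ∅, fun i => Set.empty_subset F, fun i j _ => Set.disjoint_empty _,
      fun i => ⟨by simp, by simp, by simp, fun v => ⟨v, ?_, SimpleGraph.Reachable.refl v⟩⟩⟩
    rw [hR i]
    trivial
  · push Not at hR
    obtain ⟨i, hi⟩ := hR
    obtain ⟨a, haF, hat, hah, ha⟩ := D.exists_arc_extending h hi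
    obtain ⟨B, hBF, hBd, hB⟩ := ih _ (by
      rw [← hn]
      refine Finset.sum_lt_sum (fun j _ => Set.ncard_le_ncard ?_)
        ⟨i, Finset.mem_univ i, Set.ncard_lt_ncard ?_⟩
      · rcases eq_or_ne j i with rfl | hji
        · rw [Function.update_self]
          exact Set.compl_subset_compl.2 (Set.subset_insert _ _)
        · rw [Function.update_of_ne hji]
      · rw [Function.update_self]
        exact compl_lt_compl_iff_lt.2 (Set.ssubset_insert hah)) (F \ {a})
      (Function.update R i (insert (D.head a) (R i))) ha rfl
    have haB : ∀ j, a ∉ B j := fun j hj => (hBF j hj).2 rfl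
    refine ⟨Function.update B i (insert a (B i)), fun j => ?_, fun j l hjl => ?_, fun j => ?_⟩
    · rcases eq_or_ne j i with rfl | hji
      · rw [Function.update_self]
        exact Set.insert_subset haF ((hBF j).trans Set.sdiff_subset)
      · rw [Function.update_of_ne hji]
        exact (hBF j).trans Set.sdiff_subset
    · rcases eq_or_ne j i with rfl | hji
      · rw [Function.update_self, Function.update_of_ne hjl.symm, Set.disjoint_insert_left]
        exact ⟨haB l, hBd hjl⟩
      · rw [Function.update_of_ne hji]
        rcases eq_or_ne l i with rfl | hli
        · rw [Function.update_self, Set.disjoint_insert_right]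
          exact ⟨haB j, hBd hjl⟩
        · rw [Function.update_of_ne hli]
          exact hBd hjl
    · have hBj := hB j
      rcases eq_or_ne j i with rfl | hji
      · rw [Function.update_self] at hBj ⊢
        exact hBj.insert hat hah
      · rwa [Function.update_of_ne hji] at hBj ⊢

end Edmonds

/-! ### Branchings with one root and arborescences -/

theorem edgeSet_fromEdgeSet_ends (D : DirMultigraph V A) {T : Set A}
    (hT : ∀ a ∈ T, D.tail a ≠ D.head a) :
    (SimpleGraph.fromEdgeSet (D.ends '' T)).edgeSet = D.ends '' T := by
  rw [SimpleGraph.edgeSet_fromEdgeSet, sdiff_eq_left, Set.disjoint_left]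
  rintro _ ⟨a, ha, rfl⟩
  exact hT a ha

/-- The heads are distinct and differ from `r`, so there are at most `|V| - 1` arcs; connectedness
needs at least that many edges. Equality excludes parallel arcs and cycles. -/
theorem IsSpanningBranching.isArborescence [Finite V] [Finite A] {D : DirMultigraph V A} {r : V}
    {B : Set A} (hB : D.IsSpanningBranching {r} B) : D.IsArborescence B := by
  have hreach : ∀ v, (SimpleGraph.fromEdgeSet (D.ends '' B)).Reachable r v := fun v => by
    obtain ⟨u, rfl, hu⟩ := hB.reachable v
    exact hu
  have hconn : (SimpleGraph.fromEdgeSet (D.ends '' B)).Connected :=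
    (SimpleGraph.connected_iff_exists_forall_reachable _).2 ⟨r, hreach⟩
  have h1 := hconn.card_vert_le_card_edgeSet_add_one
  rw [D.edgeSet_fromEdgeSet_ends hB.loopless, Nat.card_coe_set_eq] at h1
  have h2 : B.ncard ≤ ({r}ᶜ : Set V).ncard :=
    Set.ncard_le_ncard_of_injOn D.head hB.head_notMem hB.head_injOn
  have h3 := Set.ncard_add_ncard_compl ({r} : Set V)
  rw [Set.ncard_singleton] at h3
  have h4 : (D.ends '' B).ncard ≤ B.ncard := Set.ncard_image_le
  refine ⟨⟨hB.loopless, Set.injOn_of_ncard_image_eq (by omega), ?_⟩, fun v => ?_⟩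
  · refine SimpleGraph.isTree_iff_connected_and_card.2 ⟨hconn, ?_⟩
    rw [D.edgeSet_fromEdgeSet_ends hB.loopless, Nat.card_coe_set_eq]
    omega
  · exact Set.encard_le_one_iff.2 fun a b ha hb =>
      hB.head_injOn ha.1 hb.1 (ha.2.2.trans hb.2.2.symm)

/-- An arborescence has a root: it enters all nonempty sets that do not contain the root. -/
theorem IsArborescence.exists_root [Finite V] [Finite A] {D : DirMultigraph V A} {T : Set A}
    (hT : D.IsArborescence T) :
    ∃ r, ∀ X : Set V, X.Nonempty → r ∉ X → (T ∩ D.deltaIn X).Nonempty := by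
  have hl := hT.isSpanningTree.loopless
  obtain ⟨hconn, hcard⟩ := SimpleGraph.isTree_iff_connected_and_card.1 hT.isSpanningTree.isTree
  rw [D.edgeSet_fromEdgeSet_ends hl, Nat.card_coe_set_eq,
    hT.isSpanningTree.no_parallel.ncard_image] at hcard
  have h1 : (D.head '' T).ncard ≤ T.ncard := Set.ncard_image_le
  -- The tree has only `|V| - 1` arcs, so some node is no head.
  obtain ⟨r, hr⟩ : ∃ r, r ∉ D.head '' T := by
    by_contra! hall
    rw [Set.eq_univ_of_forall hall, Set.ncard_univ] at h1
    omega
  have hin : ∀ a ∈ T, ∀ b ∈ T, D.head a = D.head b → a = b := fun a ha b hb hab =>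
    Set.encard_le_one_iff.1 (hT.inDegree_le_one (D.head b)) a b
      ⟨ha, fun h => hl a ha (h.trans hab.symm), hab⟩ ⟨hb, hl b hb, rfl⟩
  have hreach : ∀ v, Relation.ReflTransGen
      (fun x y => ∃ a ∈ T, D.tail a = x ∧ D.head a = y) r v := by
    intro v
    have hv := (SimpleGraph.reachable_iff_reflTransGen r v).1 (hconn.preconnected r v)
    induction hv with
    | refl => exact Relation.ReflTransGen.refl
    | @tail w x _ hwx ih =>
      obtain ⟨⟨a, haT, ha⟩, -⟩ := (SimpleGraph.fromEdgeSet_adj _).1 hwx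
      rcases Sym2.eq_iff.1 ha with ⟨h1, h2⟩ | ⟨h1, h2⟩
      · exact ih.tail ⟨a, haT, h1, h2⟩
      -- The undirected path uses `a` backwards. Its head is not `r`, and by in-degree one `a` is
      -- the last arc of the directed path to that head, so its tail was already reached.
      · rcases Relation.ReflTransGen.cases_tail ih with h | ⟨y, hy, b, hbT, hb1, hb2⟩
        · exact absurd ⟨a, haT, h2.trans h⟩ hr
        · rw [← h1, hin a haT b hbT (h2.trans hb2.symm), hb1]
          exact hy
  refine ⟨r, fun X ⟨v, hv⟩ hrX => ?_⟩
  by_contra hX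
  refine Relation.ReflTransGen.head_induction_on (motive := fun u _ => u ∉ X → False)
    (hreach v) (fun h => h hv) ?_ hrX
  rintro u w ⟨a, haT, rfl, rfl⟩ - ih hu
  exact ih fun hw => hX ⟨a, haT, hu, hw⟩

theorem IsArborescence.card_le_sum_ncard_add_one [Finite V] [Finite A] {D : DirMultigraph V A}
    {T : Set A} (hT : D.IsArborescence T) {P : Finset (Set V)} (hP : IsSubpartition P) :
    P.card ≤ ∑ X ∈ P, (T ∩ D.deltaIn X).ncard + 1 := by
  classical
  obtain ⟨r, hr⟩ := hT.exists_root
  have h1 : (P.filter fun X => r ∈ X).card ≤ 1 := by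
    refine Finset.card_le_one.2 fun X hX Y hY => ?_
    rw [Finset.mem_filter] at hX hY
    by_contra hne
    exact Set.disjoint_left.1 (hP.pairwiseDisjoint hX.1 hY.1 hne) hX.2 hY.2
  rw [Finset.card_filter] at h1
  refine le_trans ?_ (add_le_add_right h1 _)
  rw [← Finset.sum_add_distrib, Finset.card_eq_sum_ones]
  refine Finset.sum_le_sum fun X hX => ?_
  by_cases hrX : r ∈ X
  · rw [if_pos hrX]; omega
  · have := (Set.ncard_pos (Set.toFinite _)).2 (hr X (hP.nonempty X hX) hrX)
    omega

theorem IsKArborescence.mul_card_le_sum_ncard_add [Finite V] [Finite A] {D : DirMultigraph V A}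
    {k : ℕ} {F : Set A} (hF : D.IsKArborescence k F) {P : Finset (Set V)} (hP : IsSubpartition P) :
    k * P.card ≤ ∑ X ∈ P, (F ∩ D.deltaIn X).ncard + k := by
  obtain ⟨T, hT, hd, rfl⟩ := hF
  have h1 : ∀ X, ((⋃ i, T i) ∩ D.deltaIn X).ncard = ∑ i, (T i ∩ D.deltaIn X).ncard := fun X => by
    rw [Set.iUnion_inter, Set.ncard_iUnion_of_finite (fun _ => Set.toFinite _)
      (fun i j hij => (hd hij).mono Set.inter_subset_left Set.inter_subset_left),
      finsum_eq_sum_of_fintype]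
  simp only [h1]
  rw [Finset.sum_comm]
  have h2 := Finset.sum_le_sum fun i (_ : i ∈ Finset.univ) => (hT i).card_le_sum_ncard_add_one hP
  simpa [Finset.sum_add_distrib] using h2

/-! ### Ranks in the direct sum -/

theorem ncard_le_sumRank [Finite A] (D : DirMultigraph V A) (M : V → Matroid A)
    (hM : ∀ v, (M v).E = D.deltaIn {v}) {F : Set A}
    (hF : ∀ v, (M v).Indep (F ∩ D.deltaIn {v})) (X : Set V) :
    (F ∩ D.deltaIn X).ncard ≤ D.sumRank M hM (D.deltaIn X) := by
  have hI : (D.directSum M hM).Indep (F ∩ D.deltaIn X) := by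
    rw [directSum, Matroid.disjointSigma_indep_iff]
    refine ⟨fun v => (hF v).subset ?_, fun a ha => ?_⟩
    · rw [hM]
      exact Set.inter_subset_inter_left _ Set.inter_subset_left
    · simp only [hM, Set.mem_iUnion]
      exact ⟨D.head a, D.ne_of_mem_deltaIn ha.2, rfl⟩
  exact ENat.toNat_le_toNat (hI.encard_le_eRk_of_subset Set.inter_subset_right)
    ((D.directSum M hM).isRkFinite_of_finite (Set.toFinite _)).eRk_lt_top.ne

/-- A basis of the cut in the direct sum splits by heads into sets independent in the single
matroids. -/
theorem sumRank_le_cutRank [Fintype V] [Finite A] (D : DirMultigraph V A) (M : V → Matroid A)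
    (hM : ∀ v, (M v).E = D.deltaIn {v}) (X : Set V) :
    D.sumRank M hM (D.deltaIn X) ≤ D.cutRank (fun v S => ((M v).eRk S).toNat) X := by
  obtain ⟨I, hI⟩ := (D.directSum M hM).exists_isBasis' (D.deltaIn X)
  rw [sumRank, hI.eRk_eq_encard, ← Set.ncard_def,
    D.ncard_eq_sum_ncard_inter_deltaIn fun a ha => D.ne_of_mem_deltaIn (hI.subset ha)]
  refine Finset.sum_le_sum fun v _ => ENat.toNat_le_toNat (Matroid.Indep.encard_le_eRk_of_subset ?_
    (Set.inter_subset_inter_left _ hI.subset))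
    ((M v).isRkFinite_of_finite (Set.toFinite _)).eRk_lt_top.ne
  have h1 := hI.indep
  rw [directSum, Matroid.disjointSigma_indep_iff] at h1
  have h2 := h1.1 v
  rwa [hM] at h2

end DirMultigraph

/-! ### The characterization -/

theorem mainTheorem5 {V A : Type*} [Finite V] [Nonempty V] [Finite A]
    (D : DirMultigraph V A) (k : ℕ) (M : V → Matroid A)
    (hM : ∀ v, (M v).E = D.deltaIn {v}) :
    (∃ F : Set A, D.IsMatroidRestrictedKArborescence M k F) ↔
      ∀ P : Finset (Set V), IsSubpartition P →
        (∑ X ∈ P, (D.sumRank M hM (D.deltaIn X) : ℤ)) ≥ (k : ℤ) * ((P.card : ℤ) - 1) := by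
  have := Fintype.ofFinite V
  constructor
  · rintro ⟨F, hk, hF⟩ P hP
    have h1 := hk.mul_card_le_sum_ncard_add hP
    have h2 := Finset.sum_le_sum fun X (_ : X ∈ P) => D.ncard_le_sumRank M hM hF X
    have h3 : k * P.card ≤ ∑ X ∈ P, D.sumRank M hM (D.deltaIn X) + k := by omega
    zify at h3
    linarith
  · intro h
    have hρ : ∀ v, IsRankFunction fun S => ((M v).eRk S).toNat :=
      fun v => (M v).isRankFunction_toNat_eRk
    obtain ⟨m, hm, hcut⟩ := D.exists_roots hρ k fun P hP => by
      have h1 := h P hP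
      have h2 := Finset.sum_le_sum fun X (_ : X ∈ P) => D.sumRank_le_cutRank M hM X
      have h3 : k * P.card ≤ ∑ X ∈ P, D.sumRank M hM (D.deltaIn X) + k := by
        zify
        linarith
      omega
    obtain ⟨F, hF, hFcut⟩ := D.exists_indep_forall_le_ncard hρ (fun X Y => by
      rw [← Finset.sum_add_distrib, ← Finset.sum_add_distrib]
      refine Finset.sum_le_sum fun v _ => le_of_eq ?_
      rw [add_comm, Set.indicator_union_add_inter_apply]) hcut
    obtain ⟨r, hr⟩ := DirMultigraph.exists_family_of_sum_eq hm
    obtain ⟨B, hBF, hBd, hB⟩ :=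
      D.exists_disjoint_spanningBranchings F (fun i => {r i}) fun X hX => by
        classical
        have h1 := hFcut X hX
        have h2 := hr (X.indicator 1)
        -- Each of the `k` roots lies either outside or inside `X`, so `k - m(X)` is exactly the
        -- demand in Edmonds' condition.
        have h3 : DirMultigraph.avoidCount (fun i => {r i}) X + ∑ i, X.indicator 1 (r i) = k := by
          rw [DirMultigraph.avoidCount, ← Finset.sum_add_distrib]
          refine (Finset.sum_congr rfl fun i _ => ?_).trans (b := ∑ _ : Fin k, 1) (by simp)
          by_cases hi : r i ∈ X <;> simp [hi]
        have h4 : ∑ v, m v * X.indicator 1 v = ∑ v, X.indicator m v :=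
          Finset.sum_congr rfl fun v _ => by by_cases hv : v ∈ X <;> simp [hv]
        omega
    refine ⟨⋃ i, B i, ⟨B, fun i => (hB i).isArborescence, hBd, rfl⟩, fun v => ?_⟩
    refine Matroid.Indep.subset (J := F ∩ D.deltaIn {v}) ?_
      (Set.inter_subset_inter_left _ (Set.iUnion_subset hBF))
    rw [Matroid.indep_iff_eRk_eq_encard_of_finite (Set.toFinite _)]
    refine le_antisymm ((M v).eRk_le_encard _) ?_
    have h1 := hF v
    have h2 : (M v).eRk (F ∩ D.deltaIn {v}) ≠ ⊤ :=
      ((M v).isRkFinite_of_finite (Set.toFinite _)).eRk_lt_top.ne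
    rw [← ENat.natCast_toNat h2, ← (Set.toFinite (F ∩ D.deltaIn {v})).cast_ncard_eq]
    exact_mod_cast h1
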